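/- Let $k$ be a commutative ring and let $R=\bigoplus_{i\in\mathbb Z}R_i$ and $S=\bigoplus_{i\in\mathbb Z}S_i$ be $\mathbb Z$-graded $k$-algebras. Write $\mathrm{gr}\text{-}R$ for the category of $\mathbb Z$-graded right $R$-modules with degree-preserving $R$-linear maps, and let $\mathcal S_R:\mathrm{gr}\text{-}R\to\mathrm{gr}\text{-}R$ be the shift functor $M\mapsto M\langle 1\rangle$, where $M\langle 1\rangle_j=M_{j-1}$; similarly for $S$. Let $\Phi:\mathrm{gr}\text{-}R\to\mathrm{gr}\text{-}S$ be a $k$-linear equivalence of categories with quasi-inverse $\Psi$, and put $\Phi^*\mathcal S_S=\Psi\circ\mathcal S_S\circ\Phi$. Call $\Phi$ a graded Morita equivalence if there are a graded right $R$-module $P$ which is a progenerator of the category of all right $R$-modules (that is, $P$ is a finitely generated projective generator) and an isomorphism of graded $k$-algebras $S\cong\mathrm{End}_R(P)$ such that $\Phi$ is naturally isomorphic to $\mathrm{Hom}_R(P,-)$. Here, for a graded right $R$-module $N$, $\mathrm{Hom}_R(P,N)$ is the module of all $R$-linear maps $P\to N$; its degree $n$ part consists of the maps $f$ with $f(P_j)\subseteq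 N_{j+n}$ for all $j$, and $S\cong\mathrm{End}_R(P)$ acts on it from the right by composition. Then $\Phi$ is a graded Morita equivalence if and only if $\Phi^*\mathcal S_S\cong\mathcal S_R$ as functors $\mathrm{gr}\text{-}R\to\mathrm{gr}\text{-}R$. -/

import Mathlib

universe v u w

open CategoryTheory MulOpposite

noncomputable section

namespace GradedMorita

variable {k : Type v} [CommRing k]

section Category

variable {A : Type u} [Ring A] [Algebra k A]

/-- A `ℤ`-graded right module over the `ℤ`-graded `k`-algebra `A = ⨁ i, 𝒜 i`. Right modules are
modules over the opposite ring; the compatible `k`-module structure is the one induced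
by `k → A`. -/
structure GrMod (𝒜 : ℤ → Submodule k A) where
  carrier : Type w
  [addCommGroup : AddCommGroup carrier]
  [moduleBase : Module k carrier]
  [moduleRing : Module Aᵐᵒᵖ carrier]
  [isScalarTower : IsScalarTower k Aᵐᵒᵖ carrier]
  deg : ℤ → Submodule k carrier
  isInternal : DirectSum.IsInternal deg
  smul_mem : ∀ {i j : ℤ} {m : carrier} {a : A}, m ∈ deg i → a ∈ 𝒜 j → op a • m ∈ deg (i + j)

attribute [instance] GrMod.addCommGroup GrMod.moduleBase GrMod.moduleRing GrMod.isScalarTower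

variable {𝒜 : ℤ → Submodule k A}

instance : CoeSort (GrMod.{v, u, w} 𝒜) (Type w) := ⟨GrMod.carrier⟩

/-- The `k`-module of homogeneous homomorphisms of degree `n`: the `A`-linear maps `f : M → N`
with `f (M_j) ⊆ N_{j + n}` for all `j`. -/
def homDeg (M N : GrMod.{v, u, w} 𝒜) (n : ℤ) : Submodule k (M →ₗ[Aᵐᵒᵖ] N) where
  carrier := {f | ∀ j : ℤ, ∀ m ∈ M.deg j, f m ∈ N.deg (j + n)}
  add_mem' hf hg j m hm := add_mem (hf j m hm) (hg j m hm)
  zero_mem' _ _ _ := zero_mem _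
  smul_mem' c _ hf j m hm := Submodule.smul_mem _ c (hf j m hm)

/-- The category `gr-A`: graded right modules with the degree-preserving `A`-linear maps. -/
instance : Category (GrMod.{v, u, w} 𝒜) where
  Hom M N := homDeg M N 0
  id M := ⟨LinearMap.id, fun j m hm => by simpa using hm⟩
  comp f g := ⟨g.1 ∘ₗ f.1, fun j m hm => by
    simpa using g.2 _ _ (f.2 j m hm)⟩

/-- The `A`-linear map underlying a morphism of graded modules. -/
def toLinear {M N : GrMod.{v, u, w} 𝒜} (f : M ⟶ N) : M →ₗ[Aᵐᵒᵖ] N := Subtype.val f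

/-- A degree-preserving `A`-linear map as a morphism. -/
def ofLinearMap {M N : GrMod.{v, u, w} 𝒜} (f : M →ₗ[Aᵐᵒᵖ] N)
    (hf : ∀ j : ℤ, ∀ m ∈ M.deg j, f m ∈ N.deg j) : M ⟶ N :=
  ⟨f, fun j m hm => by simpa using hf j m hm⟩

theorem toLinear_mem {M N : GrMod.{v, u, w} 𝒜} (f : M ⟶ N) {j : ℤ} {m : M} (hm : m ∈ M.deg j) :
    toLinear f m ∈ N.deg j := by
  have h := f.2 j m hm
  rwa [add_zero] at h

instance : Preadditive (GrMod.{v, u, w} 𝒜) where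
  homGroup M N := inferInstanceAs (AddCommGroup (homDeg M N 0))
  add_comp _ _ _ f f' g := Subtype.ext (LinearMap.comp_add f.1 f'.1 g.1)
  comp_add _ _ _ f g g' := Subtype.ext (LinearMap.add_comp f.1 g'.1 g.1)

instance : Linear k (GrMod.{v, u, w} 𝒜) where
  homModule M N := inferInstanceAs (Module k (homDeg M N 0))
  smul_comp _ _ _ r f g := Subtype.ext (LinearMap.ext fun m =>
    LinearMap.map_smul_of_tower (toLinear g) r (f.1 m))
  comp_smul _ _ _ _ _ _ := rfl

/-- The shifted module `M⟨1⟩`, with `M⟨1⟩_j = M_{j - 1}`. -/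
def shiftObj (M : GrMod.{v, u, w} 𝒜) : GrMod.{v, u, w} 𝒜 where
  carrier := M
  deg j := M.deg (j - 1)
  isInternal := by
    have h := (DirectSum.isInternal_submodule_iff_iSupIndep_and_iSup_eq_top _).1 M.isInternal
    refine (DirectSum.isInternal_submodule_iff_iSupIndep_and_iSup_eq_top _).2 ⟨?_, ?_⟩
    · exact h.1.comp (f := fun j : ℤ => j - 1) (sub_left_injective)
    · rw [← h.2]
      exact (Equiv.subRight (1 : ℤ)).iSup_comp (g := M.deg)
  smul_mem {i j m a} hm ha := by
    have h := M.smul_mem hm ha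
    rwa [show i - 1 + j = i + j - 1 by ring] at h

variable (𝒜) in
/-- The shift functor `M ↦ M⟨1⟩` on `gr-A`; it is the identity on underlying maps. -/
def shift : GrMod.{v, u, w} 𝒜 ⥤ GrMod.{v, u, w} 𝒜 where
  obj := shiftObj
  map {M N} f := ofLinearMap (M := shiftObj M) (N := shiftObj N)
    (toLinear (M := M) (N := N) f) fun _ _ hm => toLinear_mem (M := M) (N := N) f hm

end Category

section HomInternal

variable {A : Type u} [Ring A] [Algebra k A] {𝒜 : ℤ → Submodule k A}

instance (M : GrMod.{v, u, w} 𝒜) : DirectSum.Decomposition M.deg :=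
  M.isInternal.chooseDecomposition

/-- The projection of `M` onto its component of degree `i`. -/
def proj (M : GrMod.{v, u, w} 𝒜) (i : ℤ) : M →ₗ[k] M :=
  (M.deg i).subtype ∘ₗ DirectSum.component k ℤ (fun i => M.deg i) i ∘ₗ
    (DirectSum.decomposeLinearEquiv M.deg).toLinearMap

theorem proj_apply (M : GrMod.{v, u, w} 𝒜) (i : ℤ) (m : M) :
    proj M i m = (DirectSum.decompose M.deg m i : M) := rfl

theorem proj_of_mem (M : GrMod.{v, u, w} 𝒜) {i : ℤ} (j : ℤ) {m : M} (hm : m ∈ M.deg i) :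
    proj M j m = if i = j then m else 0 := by
  rw [proj_apply]
  split_ifs with h
  · subst h; exact DirectSum.decompose_of_mem_same _ hm
  · exact DirectSum.decompose_of_mem_ne _ hm h

theorem induction_homogeneous (M : GrMod.{v, u, w} 𝒜) {p : M → Prop} (h0 : p 0)
    (hadd : ∀ x y, p x → p y → p (x + y)) (h : ∀ i, ∀ m ∈ M.deg i, p m) (m : M) : p m :=
  DirectSum.Decomposition.inductionOn M.deg h0 (fun x => h _ x.1 x.2) hadd m

theorem proj_smul (M : GrMod.{v, u, w} 𝒜) (i : ℤ) {j : ℤ} {a : A} (ha : a ∈ 𝒜 j) (m : M) :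
    proj M (i + j) (op a • m) = op a • proj M i m := by
  induction m using induction_homogeneous with
  | h0 => simp
  | hadd x y hx hy => rw [smul_add, map_add, hx, hy, map_add, smul_add]
  | h l m hm =>
    rw [proj_of_mem M _ (M.smul_mem hm ha), proj_of_mem M _ hm]
    by_cases h : l = i <;> simp [h]

/-- The degree `n` part of a `k`-linear map. -/
def compBase {M N : GrMod.{v, u, w} 𝒜} (f : M →ₗ[k] N) (n : ℤ) : M →ₗ[k] N :=
  DirectSum.toModule k ℤ N (fun j => proj N (j + n) ∘ₗ f ∘ₗ (M.deg j).subtype) ∘ₗ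
    (DirectSum.decomposeLinearEquiv M.deg).toLinearMap

theorem compBase_of_mem {M N : GrMod.{v, u, w} 𝒜} (f : M →ₗ[k] N) (n : ℤ) {j : ℤ} {m : M}
    (hm : m ∈ M.deg j) : compBase f n m = proj N (j + n) (f m) := by
  simp only [compBase, LinearMap.comp_apply, LinearEquiv.coe_coe,
    DirectSum.decomposeLinearEquiv_apply]
  rw [DirectSum.decompose_of_mem _ hm]
  exact DirectSum.toModule_lof k (M := fun j => M.deg j) j ⟨m, hm⟩

theorem compBase_finite {M N : GrMod.{v, u, w} 𝒜} (f : M →ₗ[k] N) (m : M) :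
    {n | compBase f n m ≠ 0}.Finite := by
  induction m using induction_homogeneous with
  | h0 => simp
  | hadd x y hx hy =>
    refine (hx.union hy).subset fun n hn => ?_
    by_contra h
    simp only [Set.mem_union, Set.mem_ofPred_eq, not_or, not_not] at h
    exact hn (by rw [map_add, h.1, h.2, add_zero])
  | h j m hm =>
    refine ((DFinsupp.finite_support (DirectSum.decompose N.deg (f m))).preimage
      (f := fun n => j + n) (add_right_injective j).injOn).subset fun n hn => ?_
    intro h
    refine hn ?_
    rw [compBase_of_mem f n hm, proj_apply, h]
    rfl

theorem sum_compBase {M N : GrMod.{v, u, w} 𝒜} (f : M →ₗ[k] N) (m : M) :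
    ∀ s : Finset ℤ, {n | compBase f n m ≠ 0} ⊆ s → ∑ n ∈ s, compBase f n m = f m := by
  suffices h : ∑ᶠ n, compBase f n m = f m by
    intro s hs
    rw [← h, finsum_eq_sum_of_support_subset _ hs]
  induction m using induction_homogeneous with
  | h0 => simp
  | hadd x y hx hy =>
    simp only [map_add]
    rw [finsum_add_distrib (compBase_finite f x) (compBase_finite f y), hx, hy]
  | h j m hm =>
    classical
    simp only [compBase_of_mem f _ hm]
    refine (finsum_comp_equiv (Equiv.addLeft j) (f := fun n => proj N n (f m))).trans ?_
    rw [finsum_eq_sum_of_support_subset (s := (DirectSum.decompose N.deg (f m)).support)]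
    · exact DirectSum.sum_support_decompose N.deg (f m)
    · intro n hn
      simpa [proj_apply] using hn

variable [GradedAlgebra 𝒜]

theorem compBase_smul {M N : GrMod.{v, u, w} 𝒜} (f : M →ₗ[Aᵐᵒᵖ] N) (n : ℤ) (a : A) (m : M) :
    compBase (f.restrictScalars k) n (op a • m) =
      op a • compBase (f.restrictScalars k) n m := by
  induction m using induction_homogeneous with
  | h0 => simp
  | hadd x y hx hy => rw [smul_add, map_add, hx, hy, map_add, smul_add]
  | h j m hm =>
    induction a using DirectSum.Decomposition.inductionOn 𝒜 with
    | zero => simp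
    | add a b ha hb => rw [MulOpposite.op_add, add_smul, map_add, ha, hb, add_smul]
    | @homogeneous i a =>
      rw [compBase_of_mem _ _ (M.smul_mem hm a.2), compBase_of_mem _ _ hm]
      simp only [LinearMap.coe_restrictScalars, map_smul]
      rw [show j + i + n = j + n + i by ring, proj_smul N _ a.2]

/-- The degree `n` part of an `A`-linear map. -/
def homComp {M N : GrMod.{v, u, w} 𝒜} (n : ℤ) : (M →ₗ[Aᵐᵒᵖ] N) →ₗ[k] (M →ₗ[Aᵐᵒᵖ] N) where
  toFun f :=
    { toFun := compBase (f.restrictScalars k) n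
      map_add' := map_add _
      map_smul' := fun a m => compBase_smul f n (unop a) m }
  map_add' f g := by
    ext m
    change compBase ((f + g).restrictScalars k) n m =
      compBase (f.restrictScalars k) n m + compBase (g.restrictScalars k) n m
    induction m using induction_homogeneous with
    | h0 => simp
    | hadd x y hx hy => rw [map_add, hx, hy, map_add, map_add]; abel
    | h j m hm => simp [compBase_of_mem _ _ hm]
  map_smul' c f := by
    ext m
    change compBase ((c • f).restrictScalars k) n m = c • compBase (f.restrictScalars k) n m
    induction m using induction_homogeneous with
    | h0 => simp
    | hadd x y hx hy => rw [map_add, hx, hy, map_add, smul_add]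
    | h j m hm => simp [compBase_of_mem _ _ hm]

theorem homComp_apply {M N : GrMod.{v, u, w} 𝒜} (n : ℤ) (f : M →ₗ[Aᵐᵒᵖ] N) (m : M) :
    homComp n f m = compBase (f.restrictScalars k) n m := rfl

theorem homComp_mem {M N : GrMod.{v, u, w} 𝒜} (n : ℤ) (f : M →ₗ[Aᵐᵒᵖ] N) :
    homComp n f ∈ homDeg M N n := fun j m hm => by
  rw [homComp_apply, compBase_of_mem _ _ hm, proj_apply]
  exact SetLike.coe_mem _

theorem homComp_of_mem {M N : GrMod.{v, u, w} 𝒜} (n : ℤ) {l : ℤ} {f : M →ₗ[Aᵐᵒᵖ] N}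
    (hf : f ∈ homDeg M N l) : homComp n f = if l = n then f else 0 := by
  ext m
  induction m using induction_homogeneous with
  | h0 => simp
  | hadd x y hx hy => rw [map_add, hx, hy, map_add]
  | h j m hm =>
    rw [homComp_apply, compBase_of_mem _ _ hm, LinearMap.coe_restrictScalars,
      proj_of_mem N _ (hf j m hm)]
    by_cases h : l = n <;> simp [h]

/-- If `M` is finitely generated then `Hom_A(M, N)` is the direct sum of its submodules of
homogeneous homomorphisms. -/
theorem homDeg_isInternal (M N : GrMod.{v, u, w} 𝒜) [Module.Finite Aᵐᵒᵖ M] :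
    DirectSum.IsInternal (homDeg M N) := by
  classical
  refine ⟨?_, ?_⟩
  · refine (injective_iff_map_eq_zero _).2 fun x hx => ?_
    have key : ∀ (n : ℤ) (x : DirectSum ℤ fun n => homDeg M N n),
        homComp n (DirectSum.coeAddMonoidHom (homDeg M N) x) = x n := by
      intro n x
      induction x using DirectSum.induction_on with
      | zero => simp
      | of i f =>
        rw [DirectSum.coeAddMonoidHom_of, homComp_of_mem n f.2, DirectSum.coe_of_apply]
        split_ifs <;> rfl
      | add x y hx hy => rw [map_add, map_add, hx, hy]; rfl
    refine DFinsupp.ext fun n => Subtype.ext ?_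
    rw [← key n x, hx, map_zero]
    rfl
  · intro f
    obtain ⟨s, hs⟩ := Module.Finite.fg_top (R := Aᵐᵒᵖ) (M := M)
    have hfin : {n : ℤ | homComp n f ≠ 0}.Finite := by
      refine (s.finite_toSet.biUnion fun m _ =>
        compBase_finite (f.restrictScalars k) m).subset fun n hn => ?_
      by_contra h
      refine hn (LinearMap.ext_on hs fun m hm => ?_)
      by_contra h'
      exact h (Set.mem_biUnion hm h')
    refine ⟨∑ n ∈ hfin.toFinset, DirectSum.of (fun n => homDeg M N n) n
      ⟨homComp n f, homComp_mem n f⟩, ?_⟩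
    rw [map_sum]
    simp only [DirectSum.coeAddMonoidHom_of]
    ext m
    rw [LinearMap.sum_apply]
    refine sum_compBase (f.restrictScalars k) m hfin.toFinset fun n hn => ?_
    simp only [Set.Finite.coe_toFinset, Set.mem_ofPred_eq]
    intro h
    exact hn (by rw [← homComp_apply, h]; rfl)

end HomInternal

section Morita

variable {A B : Type u} [Ring A] [Algebra k A] [Ring B] [Algebra k B]
variable {𝒜 : ℤ → Submodule k A} [GradedAlgebra 𝒜] {ℬ : ℤ → Submodule k B}

/-- A `k`-algebra isomorphism `B ≅ End_A(P)` that matches the gradings, where `End_A(P)_i` is the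
set of endomorphisms of degree `i` and multiplication is composition. -/
structure EndIso (ℬ : ℤ → Submodule k B) (P : GrMod.{v, u, w} 𝒜) where
  toAlgEquiv : B ≃ₐ[k] Module.End Aᵐᵒᵖ P
  mem_iff : ∀ (i : ℤ) (b : B), b ∈ ℬ i ↔ toAlgEquiv b ∈ homDeg P P i

/-- For `P` finitely generated with `B ≅ End_A(P)`, the graded right `B`-module `Hom_A(P, N)`,
in which `f · b` is the composition of `f` with the endomorphism given by `b`. -/
def homObj (P : GrMod.{v, u, w} 𝒜) [Module.Finite Aᵐᵒᵖ P] (σ : EndIso ℬ P)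
    (N : GrMod.{v, u, w} 𝒜) : GrMod.{v, u, w} ℬ :=
  letI : Module Bᵐᵒᵖ (P →ₗ[Aᵐᵒᵖ] N) :=
    { smul := fun b f => f ∘ₗ σ.toAlgEquiv (unop b)
      one_smul := fun f => by
        change f ∘ₗ σ.toAlgEquiv 1 = f
        rw [map_one]; rfl
      mul_smul := fun b c f => by
        change f ∘ₗ σ.toAlgEquiv (unop c * unop b) = (f ∘ₗ σ.toAlgEquiv (unop c)) ∘ₗ _
        rw [map_mul]; rfl
      smul_zero := fun _ => LinearMap.zero_comp _
      smul_add := fun _ f g => LinearMap.add_comp _ g f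
      add_smul := fun b c f => by
        change f ∘ₗ σ.toAlgEquiv (unop b + unop c) = _
        rw [map_add]; exact LinearMap.comp_add _ _ f
      zero_smul := fun f => by
        change f ∘ₗ σ.toAlgEquiv 0 = 0
        rw [map_zero]; exact LinearMap.comp_zero f }
  { carrier := P →ₗ[Aᵐᵒᵖ] N
    isScalarTower := ⟨fun c b f => by
      change f ∘ₗ σ.toAlgEquiv (c • unop b) = c • (f ∘ₗ σ.toAlgEquiv (unop b))
      rw [map_smul]
      ext p
      exact LinearMap.map_smul_of_tower f c _⟩
    deg := homDeg P N
    isInternal := homDeg_isInternal P N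
    smul_mem := fun {i j f b} hf hb l p hp => by
      have h := hf _ _ ((σ.mem_iff j b).1 hb l p hp)
      rwa [show l + j + i = l + (i + j) by ring] at h }

/-- The functor `Hom_A(P, -) : gr-A ⥤ gr-B`. -/
def homFunctor (P : GrMod.{v, u, w} 𝒜) [Module.Finite Aᵐᵒᵖ P] (σ : EndIso ℬ P) :
    GrMod.{v, u, w} 𝒜 ⥤ GrMod.{v, u, w} ℬ where
  obj := homObj P σ
  map {M N} g := ofLinearMap (M := homObj P σ M) (N := homObj P σ N)
    { toFun := fun f => toLinear g ∘ₗ (show P →ₗ[Aᵐᵒᵖ] M from f)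
      map_add' := fun f f' => LinearMap.comp_add f f' (toLinear g)
      map_smul' := fun _ _ => rfl }
    fun j _ hf l p hp => toLinear_mem g (hf l p hp)

/-- `P` is a progenerator of the category of all (ungraded) right `A`-modules: finitely generated,
projective, and a generator. -/
structure IsProgenerator (P : GrMod.{v, u, u} 𝒜) : Prop where
  finite : Module.Finite Aᵐᵒᵖ P
  projective : Module.Projective Aᵐᵒᵖ P
  generator : IsSeparator (ModuleCat.of Aᵐᵒᵖ P)

/-- `Φ : gr-A ⥤ gr-B` is a graded Morita equivalence if it is naturally isomorphic to
`Hom_A(P, -)` for a graded module `P` that is a progenerator of `mod-A` and an isomorphism of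
graded algebras `B ≅ End_A(P)`. -/
def IsGradedMorita (Φ : GrMod.{v, u, u} 𝒜 ⥤ GrMod.{v, u, u} ℬ) : Prop :=
  ∃ (P : GrMod.{v, u, u} 𝒜) (hP : IsProgenerator P) (σ : EndIso ℬ P),
    haveI := hP.finite
    Nonempty (Φ ≅ homFunctor P σ)

/-- The pullback `Φ^* G = Ψ G Φ` of an endofunctor `G` of `gr-B` along an equivalence `Φ` with
quasi-inverse `Ψ`. -/
def pullback (Φ : GrMod.{v, u, w} 𝒜 ≌ GrMod.{v, u, w} ℬ)
    (G : GrMod.{v, u, w} ℬ ⥤ GrMod.{v, u, w} ℬ) : GrMod.{v, u, w} 𝒜 ⥤ GrMod.{v, u, w} 𝒜 :=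
  Φ.functor ⋙ G ⋙ Φ.inverse

end Morita

end GradedMorita

end

noncomputable section

namespace GradedMorita

variable {k : Type v} [CommRing k]

/-! ### Morphisms, shifts and cyclic maps of graded modules -/

section Basic

variable {A : Type u} [Ring A] [Algebra k A] {𝒜 : ℤ → Submodule k A}

/-! The functor `Hom_R(P, -)` commutes with the shifts through the identity on underlying maps
(`homFunctorShiftIso`). A functor `Φ` isomorphic to it therefore commutes with them too, and
cancelling `Ψ ∘ Φ` gives one direction.

Conversely, the hypothesis yields `θ : Φ(-)⟨1⟩ ≅ Φ(-⟨1⟩)`. A homogeneous map of degree `n = p - q`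
is a morphism `M⟨p⟩ ⟶ N⟨q⟩`, so the iterates of `θ` extend `Φ` functorially and bijectively to
homogeneous maps of every degree (`degMap_comp`, `degMap_injective`, `exists_degMap_eq`). Take `P =
Ψ(S)`. Since `Φ(P) ≅ S` is free on an element of degree `0`, evaluation there gives `Hom_R(P, N)_n ≅
Hom_S(Φ P, Φ N)_n ≅ Φ(N)_n` (`evalDeg_bijective`). For finitely generated `P` the degrees assemble
to `Hom_R(P, N) ≅ Φ(N)`; the case `N = P` is `S ≅ End_R(P)`, and functoriality of the extension
makes everything `S`-linear (`evalEquiv_comp`).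

That `P` is a progenerator is a trace argument: if a family separates morphisms, the identity of the
regular module is a finite sum of maps through its members (`Separates.id_regular_mem`). Over `S`,
applied to the modules `Φ(R⟨n⟩)` and pulled back along `Φ`, this makes `P` a retract of a finite
free module. Over `R`, applied to the `P⟨n⟩`, which separate because of `θ`, it makes `P` a
generator. -/

@[simp] theorem toLinear_comp {M N L : GrMod.{v, u, w} 𝒜} (f : M ⟶ N) (g : N ⟶ L) :
    toLinear (f ≫ g) = toLinear g ∘ₗ toLinear f := rfl

@[simp] theorem toLinear_zero (M N : GrMod.{v, u, w} 𝒜) : toLinear (0 : M ⟶ N) = 0 := rfl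

@[simp] theorem toLinear_add {M N : GrMod.{v, u, w} 𝒜} (f g : M ⟶ N) :
    toLinear (f + g) = toLinear f + toLinear g := rfl

@[simp] theorem toLinear_smul {M N : GrMod.{v, u, w} 𝒜} (c : k) (f : M ⟶ N) :
    toLinear (c • f) = c • toLinear f := rfl

@[simp] theorem toLinear_ofLinearMap {M N : GrMod.{v, u, w} 𝒜} (f : M →ₗ[Aᵐᵒᵖ] N)
    (hf : ∀ j : ℤ, ∀ m ∈ M.deg j, f m ∈ N.deg j) : toLinear (ofLinearMap f hf) = f := rfl

theorem toLinear_mem_homDeg {M N : GrMod.{v, u, w} 𝒜} (f : M ⟶ N) :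
    toLinear f ∈ homDeg M N 0 := f.2

theorem hom_ext {M N : GrMod.{v, u, w} 𝒜} {f g : M ⟶ N}
    (h : ∀ m, toLinear f m = toLinear g m) : f = g :=
  Subtype.ext (LinearMap.ext h)

/-- The linear equivalence underlying an isomorphism of graded modules. -/
def isoLinearEquiv {M N : GrMod.{v, u, w} 𝒜} (e : M ≅ N) : M ≃ₗ[Aᵐᵒᵖ] N :=
  LinearEquiv.ofLinearMap (toLinear e.hom) (toLinear e.inv)
    (by rw [← toLinear_comp, e.inv_hom_id]; rfl) (by rw [← toLinear_comp, e.hom_inv_id]; rfl)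

/-- An isomorphism of graded modules from a linear equivalence that matches the gradings. -/
def isoOfLinearEquiv {M N : GrMod.{v, u, w} 𝒜} (e : M ≃ₗ[Aᵐᵒᵖ] N)
    (h : ∀ j m, m ∈ M.deg j → e m ∈ N.deg j) (h' : ∀ j n, n ∈ N.deg j → e.symm n ∈ M.deg j) :
    M ≅ N where
  hom := ofLinearMap e.toLinearMap h
  inv := ofLinearMap e.symm.toLinearMap h'
  hom_inv_id := hom_ext e.symm_apply_apply
  inv_hom_id := hom_ext e.apply_symm_apply

theorem proj_mem (M : GrMod.{v, u, w} 𝒜) (i : ℤ) (m : M) : proj M i m ∈ M.deg i := by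
  rw [proj_apply]; exact SetLike.coe_mem _

theorem toLinear_proj {M N : GrMod.{v, u, w} 𝒜} (f : M ⟶ N) (i : ℤ) (m : M) :
    toLinear f (proj M i m) = proj N i (toLinear f m) := by
  induction m using induction_homogeneous with
  | h0 => simp
  | hadd x y hx hy => simp only [map_add, hx, hy]
  | h j m hm =>
    rw [proj_of_mem M _ hm, proj_of_mem N _ (toLinear_mem f hm)]
    split_ifs <;> simp

/-- The shifted module `M⟨n⟩`, with `M⟨n⟩_j = M_{j - n}`. -/
def shiftBy (n : ℤ) (M : GrMod.{v, u, w} 𝒜) : GrMod.{v, u, w} 𝒜 where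
  carrier := M
  deg j := M.deg (j - n)
  isInternal := by
    have h := (DirectSum.isInternal_submodule_iff_iSupIndep_and_iSup_eq_top _).1 M.isInternal
    refine (DirectSum.isInternal_submodule_iff_iSupIndep_and_iSup_eq_top _).2 ⟨?_, ?_⟩
    · exact h.1.comp (f := fun j : ℤ => j - n) (sub_left_injective)
    · rw [← h.2]
      exact (Equiv.subRight n).iSup_comp (g := M.deg)
  smul_mem {i j m a} hm ha := by
    have h := M.smul_mem hm ha
    rwa [show i - n + j = i + j - n by ring] at h

/-- A homogeneous map of degree `p - q` as a morphism `M⟨p⟩ ⟶ N⟨q⟩`. -/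
def shiftHom {M N : GrMod.{v, u, w} 𝒜} {n : ℤ} (p q : ℤ) (h : p - q = n) (f : M →ₗ[Aᵐᵒᵖ] N)
    (hf : f ∈ homDeg M N n) : shiftBy p M ⟶ shiftBy q N :=
  ofLinearMap (M := shiftBy p M) (N := shiftBy q N) f fun j m hm => by
    have := hf _ m hm
    rwa [← h, show j - p + (p - q) = j - q by ring] at this

/-- A homogeneous map of degree `n` as a morphism `M⟨n⟩ ⟶ N`. -/
def shiftHomLeft {M N : GrMod.{v, u, w} 𝒜} {n : ℤ} (f : M →ₗ[Aᵐᵒᵖ] N)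
    (hf : f ∈ homDeg M N n) : shiftBy n M ⟶ N :=
  ofLinearMap (M := shiftBy n M) (N := N) f fun j m hm => by
    have := hf _ m hm
    rwa [sub_add_cancel] at this

/-- The linear map `A → M` with `1 ↦ m`. -/
def genMap (M : Type*) [AddCommGroup M] [Module Aᵐᵒᵖ M] (m : M) : A →ₗ[Aᵐᵒᵖ] M where
  toFun a := op a • m
  map_add' a b := by rw [MulOpposite.op_add, add_smul]
  map_smul' r a := by
    rw [show r • a = a * unop r from rfl, MulOpposite.op_mul, op_unop, mul_smul]; rfl

theorem genMap_apply (M : Type*) [AddCommGroup M] [Module Aᵐᵒᵖ M] (m : M) (a : A) :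
    genMap M m a = op a • m := rfl

theorem genMap_one (M : Type*) [AddCommGroup M] [Module Aᵐᵒᵖ M] (m : M) :
    genMap M m (1 : A) = m := by
  rw [genMap_apply, MulOpposite.op_one, one_smul]

theorem linearMap_apply_eq (M : Type*) [AddCommGroup M] [Module Aᵐᵒᵖ M] (f : A →ₗ[Aᵐᵒᵖ] M)
    (a : A) : f a = op a • f 1 := by
  rw [← map_smul, show op a • (1 : A) = 1 * a from rfl, one_mul]

end Basic

/-! ### The regular module -/

section Regular

variable {A : Type u} [Ring A] [Algebra k A] (𝒜 : ℤ → Submodule k A) [GradedAlgebra 𝒜]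

/-- The algebra `A` as a graded right module over itself. -/
def regular : GrMod.{v, u, u} 𝒜 where
  carrier := A
  deg := 𝒜
  isInternal := DirectSum.Decomposition.isInternal 𝒜
  smul_mem {_ _ _ _} hm ha := SetLike.mul_mem_graded hm ha

variable {𝒜}

variable (𝒜) in
/-- The generator `1` of the regular module. -/
def regularOne : regular 𝒜 := (1 : A)

theorem one_mem_regular : regularOne 𝒜 ∈ (regular 𝒜).deg 0 := SetLike.one_mem_graded 𝒜

theorem genMap_mem {M : GrMod.{v, u, u} 𝒜} {n : ℤ} {m : M} (hm : m ∈ M.deg n) :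
    (show regular 𝒜 →ₗ[Aᵐᵒᵖ] M from genMap M m) ∈ homDeg (regular 𝒜) M n := fun j a ha => by
  have := M.smul_mem hm ha
  rwa [add_comm] at this

/-- The morphism `A ⟶ M` with `1 ↦ m`, for `m` of degree `0`. -/
def genHom {M : GrMod.{v, u, u} 𝒜} (m : M) (hm : m ∈ M.deg 0) : regular 𝒜 ⟶ M :=
  ⟨genMap M m, genMap_mem hm⟩

theorem toLinear_genHom {M : GrMod.{v, u, u} 𝒜} (m : M) (hm : m ∈ M.deg 0) (a : A) :
    toLinear (genHom m hm) a = op a • m := rfl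

theorem regular_hom_ext {M : GrMod.{v, u, u} 𝒜} {f g : regular 𝒜 ⟶ M}
    (h : toLinear f (regularOne 𝒜) = toLinear g (regularOne 𝒜)) : f = g := by
  refine hom_ext fun a => ?_
  exact (linearMap_apply_eq M (toLinear f) a).trans
    ((congrArg _ h).trans (linearMap_apply_eq M (toLinear g) a).symm)

end Regular

/-! ### Quotients by homogeneous submodules -/

section Quotient

variable {A : Type u} [Ring A] [Algebra k A] {𝒜 : ℤ → Submodule k A}

/-- The quotient of a graded module by a homogeneous submodule. -/
def quotient (M : GrMod.{v, u, w} 𝒜) (I : Submodule Aᵐᵒᵖ M)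
    (hI : ∀ i, ∀ x ∈ I, proj M i x ∈ I) : GrMod.{v, u, w} 𝒜 where
  carrier := M ⧸ I
  deg i := (M.deg i).map (I.mkQ.restrictScalars k)
  isInternal := by
    -- Homogeneity of `I` lets the projections of `M` descend; on the images of the graded pieces
    -- they pick out coefficients, which forces independence.
    let π : ℤ → (M ⧸ I) →ₗ[k] (M ⧸ I) := fun i =>
      (I.restrictScalars k).mapQ (I.restrictScalars k) (proj M i) (hI i)
    have hπ : ∀ i m, π i (I.mkQ m) = I.mkQ (proj M i m) := fun i m => rfl
    let D : ℤ → Submodule k (M ⧸ I) := fun i => (M.deg i).map (I.mkQ.restrictScalars k)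
    have hπD : ∀ i j, ∀ x ∈ D j, π i x = if j = i then x else 0 := by
      rintro i j _ ⟨m, hm, rfl⟩
      refine (hπ i m).trans ?_
      rw [proj_of_mem M i hm]
      split_ifs
      · rfl
      · exact map_zero _
    refine ⟨(injective_iff_map_eq_zero _).2 fun x hx => ?_, fun y => ?_⟩
    · have key : ∀ (n : ℤ) (x : DirectSum ℤ fun n => D n),
          π n (DirectSum.coeAddMonoidHom D x) = x n := by
        intro n x
        induction x using DirectSum.induction_on with
        | zero => simp
        | of i f =>
          rw [DirectSum.coeAddMonoidHom_of, hπD n i _ f.2, DirectSum.coe_of_apply]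
          split_ifs <;> rfl
        | add x y hx hy => rw [map_add, map_add, hx, hy]; rfl
      refine DFinsupp.ext fun n => Subtype.ext ?_
      rw [← key n x, hx, map_zero]
      rfl
    · obtain ⟨m, rfl⟩ := I.mkQ_surjective y
      induction m using induction_homogeneous with
      | h0 => exact ⟨0, by simp⟩
      | hadd x y hx hy =>
        obtain ⟨a, ha⟩ := hx
        obtain ⟨b, hb⟩ := hy
        exact ⟨a + b, by rw [map_add, ha, hb, map_add]⟩
      | h i m hm =>
        exact ⟨DirectSum.of (fun i => D i) i ⟨I.mkQ m, m, hm, rfl⟩,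
          DirectSum.coeAddMonoidHom_of _ _ _⟩
  smul_mem := by
    rintro i j _ a ⟨m, hm, rfl⟩ ha
    exact ⟨op a • m, M.smul_mem hm ha, map_smul I.mkQ _ _⟩

/-- The projection of a graded module onto its quotient by a homogeneous submodule. -/
def quotientHom (M : GrMod.{v, u, w} 𝒜) (I : Submodule Aᵐᵒᵖ M)
    (hI : ∀ i, ∀ x ∈ I, proj M i x ∈ I) : M ⟶ quotient M I hI :=
  ofLinearMap (N := quotient M I hI) I.mkQ fun _ m hm => ⟨m, hm, rfl⟩

end Quotient

/-! ### Separating families and the trace of the regular module -/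

section Separating

variable {A : Type u} [Ring A] [Algebra k A] {𝒜 : ℤ → Submodule k A}

/-- A family of graded modules that detects nonzero morphisms. -/
def Separates {ι : Type*} (X : ι → GrMod.{v, u, w} 𝒜) : Prop :=
  ∀ ⦃M N : GrMod.{v, u, w} 𝒜⦄ (f : M ⟶ N), (∀ (i : ι) (h : X i ⟶ M), h ≫ f = 0) → f = 0

/-- The sums of endomorphisms of `M` that factor through a member of the family `X`. -/
def traceSubmonoid {ι : Type*} (X : ι → GrMod.{v, u, w} 𝒜) (M : GrMod.{v, u, w} 𝒜) :
    AddSubmonoid (M ⟶ M) :=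
  AddSubmonoid.closure {g | ∃ (i : ι) (c : M ⟶ X i) (d : X i ⟶ M), c ≫ d = g}

section

variable [GradedAlgebra 𝒜]

/-- The images of all maps from the family sum to a homogeneous right ideal `I`. Every such map dies
in the quotient by `I`, so separation makes the quotient map zero and `1 ∈ I`. Writing `1` as a sum
of images gives the factorizations. -/
theorem Separates.id_regular_mem {ι : Type*} {X : ι → GrMod.{v, u, u} 𝒜} (hX : Separates X) :
    𝟙 (regular 𝒜) ∈ traceSubmonoid X (regular 𝒜) := by
  let I : Submodule Aᵐᵒᵖ (regular 𝒜) :=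
    ⨆ p : Σ i, (X i ⟶ regular 𝒜), LinearMap.range (toLinear p.2)
  have hI : ∀ i, ∀ x ∈ I, proj (regular 𝒜) i x ∈ I := by
    intro i x hx
    refine Submodule.iSup_induction _ hx (motive := fun x => proj (regular 𝒜) i x ∈ I)
      ?_ ?_ ?_
    · rintro p _ ⟨y, rfl⟩
      rw [← toLinear_proj]
      exact Submodule.mem_iSup_of_mem p ⟨_, rfl⟩
    · rw [map_zero]; exact zero_mem _
    · intro x y hx hy
      rw [map_add]; exact add_mem hx hy
  have hq : quotientHom (regular 𝒜) I hI = 0 := by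
    refine hX _ fun i h => hom_ext fun x => ?_
    exact (Submodule.Quotient.mk_eq_zero I).2
      (Submodule.mem_iSup_of_mem (p := fun p : Σ i, (X i ⟶ regular 𝒜) =>
        LinearMap.range (toLinear p.2)) ⟨i, h⟩ ⟨x, rfl⟩)
  have h1 : regularOne 𝒜 ∈ I :=
    (Submodule.Quotient.mk_eq_zero I).1
      (congrArg (fun f => toLinear f (regularOne 𝒜)) hq)
  -- An element `y` with image in `I` need not be homogeneous, and only degree `0` elements define
  -- morphisms from the regular module; hence the projection, which commutes with morphisms and
  -- fixes `1`.
  have key : ∀ a ∈ I, genHom (proj (regular 𝒜) 0 a) (proj_mem _ _ _) ∈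
      traceSubmonoid X (regular 𝒜) := by
    intro a ha
    refine Submodule.iSup_induction _ ha (motive := fun a =>
      genHom (proj (regular 𝒜) 0 a) (proj_mem _ _ _) ∈ traceSubmonoid X (regular 𝒜)) ?_ ?_ ?_
    · rintro p _ ⟨y, rfl⟩
      refine AddSubmonoid.subset_closure
        ⟨p.1, genHom (proj _ 0 y) (proj_mem _ _ _), p.2, hom_ext fun (a : A) => ?_⟩
      refine (map_smul (toLinear p.2) (op a) _).trans ?_
      rw [toLinear_proj]
      rfl
    · convert zero_mem (traceSubmonoid X (regular 𝒜)) using 1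
      refine hom_ext fun (a : A) => (toLinear_genHom _ _ a).trans ?_
      rw [map_zero, smul_zero]; rfl
    · intro x y hx hy
      convert add_mem hx hy using 1
      refine hom_ext fun (a : A) => (toLinear_genHom _ _ a).trans ?_
      rw [map_add, smul_add]; rfl
  convert key _ h1 using 1
  refine regular_hom_ext ((toLinear_genHom _ _ _).trans ?_).symm
  rw [proj_of_mem _ _ one_mem_regular, if_pos rfl]
  exact one_smul Aᵐᵒᵖ (regularOne 𝒜)

/-- An element of degree `n` is the image of `1` under a morphism from the `n`-th shift of the
regular module. -/
theorem separates_shiftBy_regular : Separates fun n : ℤ => shiftBy n (regular 𝒜) := by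
  intro M N f hf
  refine hom_ext fun m => ?_
  induction m using induction_homogeneous with
  | h0 => rw [map_zero, map_zero]
  | hadd x y hx hy => rw [map_add, map_add, hx, hy]
  | h n m hm =>
    have := congrArg (fun g : shiftBy n (regular 𝒜) ⟶ N => toLinear g (regularOne 𝒜))
      (hf n (shiftHomLeft (genMap M m) (genMap_mem hm)))
    rw [← genMap_one (A := A) M m]
    exact this

end

variable {B : Type u} [Ring B] [Algebra k B] {ℬ : ℤ → Submodule k B}

theorem Separates.map_equivalence {ι : Type*} {X : ι → GrMod.{v, u, w} 𝒜} (hX : Separates X)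
    (Φ : GrMod.{v, u, w} 𝒜 ≌ GrMod.{v, u, w} ℬ) [Φ.functor.Additive] :
    Separates fun i => Φ.functor.obj (X i) := by
  intro M N f hf
  refine Φ.inverse.map_injective ?_
  rw [Functor.map_zero]
  refine hX _ fun i h => Φ.functor.map_injective ?_
  -- A map into `Φ.inverse.obj M` is tested through its transpose along the counit.
  have h1 := hf i (Φ.functor.map h ≫ Φ.counit.app M)
  rw [Functor.map_zero, Functor.map_comp, ← cancel_mono (Φ.counit.app N), Limits.zero_comp,
    Category.assoc]
  exact (congrArg (Φ.functor.map h ≫ ·) (Φ.counit_naturality f)).trans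
    ((Category.assoc _ _ _).symm.trans h1)

end Separating

/-! ### Extending `Φ` to homogeneous maps of arbitrary degree -/

section Extend

variable {A : Type u} [Ring A] [Algebra k A] {𝒜 : ℤ → Submodule k A}
variable {B : Type u} [Ring B] [Algebra k B] {ℬ : ℤ → Submodule k B}

theorem isoLinearEquiv_mem_iff {M N : GrMod.{v, u, w} 𝒜} (e : M ≅ N) {j : ℤ} {m : M} :
    isoLinearEquiv e m ∈ N.deg j ↔ m ∈ M.deg j := by
  refine ⟨fun h => ?_, fun h => toLinear_mem e.hom h⟩
  rw [← (isoLinearEquiv e).symm_apply_apply m]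
  exact toLinear_mem e.inv h

/-- The isomorphism `M ≅ M⟨0⟩`. -/
def shiftByZero (M : GrMod.{v, u, w} 𝒜) : M ≅ shiftBy (0 : ℕ) M :=
  isoOfLinearEquiv (M := M) (N := shiftBy (0 : ℕ) M) (LinearEquiv.refl Aᵐᵒᵖ M)
    (fun j m hm => by change m ∈ M.deg (j - (0 : ℕ)); simpa using hm)
    (fun j m (hm : m ∈ M.deg (j - (0 : ℕ))) => by change m ∈ M.deg j; simpa using hm)

/-- The isomorphism `M⟨n⟩⟨1⟩ ≅ M⟨n + 1⟩`. -/
def shiftBySucc (n : ℕ) (M : GrMod.{v, u, w} 𝒜) :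
    shiftObj (shiftBy n M) ≅ shiftBy (n + 1 : ℕ) M :=
  isoOfLinearEquiv (M := shiftObj (shiftBy n M)) (N := shiftBy (n + 1 : ℕ) M)
    (LinearEquiv.refl Aᵐᵒᵖ M)
    (fun j m (hm : m ∈ M.deg (j - 1 - n)) => by
      change m ∈ M.deg (j - (n + 1 : ℕ))
      rwa [show j - (n + 1 : ℕ) = j - 1 - n by push_cast; ring])
    (fun j m (hm : m ∈ M.deg (j - (n + 1 : ℕ))) => by
      change m ∈ M.deg (j - 1 - n)
      rwa [show j - 1 - n = j - (n + 1 : ℕ) by push_cast; ring])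

variable {Φ : GrMod.{v, u, w} 𝒜 ⥤ GrMod.{v, u, w} ℬ} (θ : Φ ⋙ shift ℬ ≅ shift 𝒜 ⋙ Φ)

/-- The linear equivalence underlying a component of `θ : Φ(-)⟨1⟩ ≅ Φ(-⟨1⟩)`. -/
def shiftEquiv (M : GrMod.{v, u, w} 𝒜) : Φ.obj M ≃ₗ[Bᵐᵒᵖ] Φ.obj (shiftObj M) :=
  isoLinearEquiv (M := shiftObj (Φ.obj M)) (N := Φ.obj (shiftObj M)) (θ.app M)

theorem shiftEquiv_mem_iff (M : GrMod.{v, u, w} 𝒜) {j : ℤ} {x : Φ.obj M} :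
    shiftEquiv θ M x ∈ (Φ.obj (shiftObj M)).deg j ↔ x ∈ (Φ.obj M).deg (j - 1) :=
  isoLinearEquiv_mem_iff (M := shiftObj (Φ.obj M)) (N := Φ.obj (shiftObj M)) (θ.app M)

theorem shiftEquiv_naturality {M N : GrMod.{v, u, w} 𝒜} (f : M ⟶ N) (x : Φ.obj M) :
    toLinear (Φ.map ((shift 𝒜).map f)) (shiftEquiv θ M x) =
      shiftEquiv θ N (toLinear (Φ.map f) x) :=
  congrArg (fun g : shiftObj (Φ.obj M) ⟶ Φ.obj (shiftObj N) => toLinear g x)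
    (θ.hom.naturality f).symm

theorem map_comp_apply (Φ : GrMod.{v, u, w} 𝒜 ⥤ GrMod.{v, u, w} ℬ) {M N L : GrMod.{v, u, w} 𝒜}
    (f : M ⟶ N) (g : N ⟶ L) (x : Φ.obj M) :
    toLinear (Φ.map (f ≫ g)) x = toLinear (Φ.map g) (toLinear (Φ.map f) x) := by
  rw [Φ.map_comp]; rfl

/-- The iterate `Φ(M) ≃ Φ(M⟨n⟩)` of the components of `θ`. -/
def iterEquiv : (n : ℕ) → (M : GrMod.{v, u, w} 𝒜) → Φ.obj M ≃ₗ[Bᵐᵒᵖ] Φ.obj (shiftBy n M)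
  | 0, M => isoLinearEquiv (Φ.mapIso (shiftByZero M))
  | n + 1, M => (iterEquiv n M).trans ((shiftEquiv θ (shiftBy n M)).trans
      (isoLinearEquiv (Φ.mapIso (shiftBySucc n M))))

theorem iterEquiv_succ (n : ℕ) (M : GrMod.{v, u, w} 𝒜) (x : Φ.obj M) :
    iterEquiv θ (n + 1) M x = toLinear (Φ.map (shiftBySucc n M).hom)
      (shiftEquiv θ (shiftBy n M) (iterEquiv θ n M x)) := rfl

theorem iterEquiv_mem_iff (n : ℕ) (M : GrMod.{v, u, w} 𝒜) {j : ℤ} {x : Φ.obj M} :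
    iterEquiv θ n M x ∈ (Φ.obj (shiftBy n M)).deg j ↔ x ∈ (Φ.obj M).deg (j - n) := by
  induction n generalizing j with
  | zero =>
    refine (isoLinearEquiv_mem_iff (Φ.mapIso (shiftByZero M))).trans ?_
    simp
  | succ n ih =>
    refine (isoLinearEquiv_mem_iff (Φ.mapIso (shiftBySucc n M))).trans ?_
    refine (shiftEquiv_mem_iff θ (shiftBy n M)).trans ?_
    refine ih.trans ?_
    rw [show j - 1 - n = j - (n + 1 : ℕ) by push_cast; ring]

/-- The conjugate of `Φ(f)`, for `f : M⟨p⟩ ⟶ N⟨q⟩`, by the iterates of `θ`. -/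
def conjMap {M N : GrMod.{v, u, w} 𝒜} (p q : ℕ) (f : shiftBy p M ⟶ shiftBy q N) :
    Φ.obj M →ₗ[Bᵐᵒᵖ] Φ.obj N :=
  (iterEquiv θ q N).symm.toLinearMap ∘ₗ toLinear (Φ.map f) ∘ₗ (iterEquiv θ p M).toLinearMap

theorem conjMap_eq_iff {M N : GrMod.{v, u, w} 𝒜} {p q : ℕ} {f : shiftBy p M ⟶ shiftBy q N}
    {x : Φ.obj M} {y : Φ.obj N} :
    conjMap θ p q f x = y ↔ toLinear (Φ.map f) (iterEquiv θ p M x) = iterEquiv θ q N y :=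
  (iterEquiv θ q N).symm_apply_eq

theorem conjMap_mem {M N : GrMod.{v, u, w} 𝒜} (p q : ℕ) (f : shiftBy p M ⟶ shiftBy q N) :
    conjMap θ p q f ∈ homDeg (Φ.obj M) (Φ.obj N) (p - q) := fun j x hx => by
  rw [show j + (p - q : ℤ) = j + p - q by ring, ← iterEquiv_mem_iff θ,
    ← (conjMap_eq_iff θ).1 rfl]
  refine toLinear_mem _ ((iterEquiv_mem_iff θ p M).2 ?_)
  rwa [add_sub_cancel_right]

theorem conjMap_comp {M N L : GrMod.{v, u, w} 𝒜} {p q r : ℕ} (f : shiftBy p M ⟶ shiftBy q N)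
    (g : shiftBy q N ⟶ shiftBy r L) :
    conjMap θ p r (f ≫ g) = conjMap θ q r g ∘ₗ conjMap θ p q f := by
  refine LinearMap.ext fun x => (conjMap_eq_iff θ).2 ?_
  rw [LinearMap.comp_apply, ← (conjMap_eq_iff θ).1 rfl, ← (conjMap_eq_iff θ).1 rfl, Φ.map_comp]
  rfl

/-- This is naturality of `θ`. The hypothesis `h` says that `f` and `f'` have the same underlying
map. -/
theorem conjMap_succ {M N : GrMod.{v, u, w} 𝒜} {p q : ℕ} (f : shiftBy p M ⟶ shiftBy q N)
    (f' : shiftBy (p + 1 : ℕ) M ⟶ shiftBy (q + 1 : ℕ) N)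
    (h : (shiftBySucc p M).hom ≫ f' = (shift 𝒜).map f ≫ (shiftBySucc q N).hom) :
    conjMap θ (p + 1) (q + 1) f' = conjMap θ p q f := by
  refine LinearMap.ext fun x => (conjMap_eq_iff θ).2 ?_
  rw [iterEquiv_succ, iterEquiv_succ, ← (conjMap_eq_iff θ).1 rfl, ← shiftEquiv_naturality]
  exact (map_comp_apply Φ _ _ _).symm.trans ((congrArg (fun g => toLinear (Φ.map g)
    (shiftEquiv θ (shiftBy p M) (iterEquiv θ p M x))) h).trans (map_comp_apply Φ _ _ _))

/-- The extension of `Φ` depends only on the difference of the two shifts, so it is well defined on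
homogeneous maps. -/
theorem conjMap_shiftHom_add {M N : GrMod.{v, u, w} 𝒜} {n : ℤ} {p q : ℕ} (r : ℕ)
    (h : (p : ℤ) - q = n) (h' : ((p + r : ℕ) : ℤ) - (q + r : ℕ) = n) (f : M →ₗ[Aᵐᵒᵖ] N)
    (hf : f ∈ homDeg M N n) :
    conjMap θ (p + r) (q + r) (shiftHom _ _ h' f hf) = conjMap θ p q (shiftHom _ _ h f hf) := by
  induction r with
  | zero => rfl
  | succ r ih =>
    rw [← ih (by push_cast; linarith)]
    exact conjMap_succ θ (shiftHom (p + r : ℕ) (q + r : ℕ) (by push_cast; linarith) f hf)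
      (shiftHom (p + r + 1 : ℕ) (q + r + 1 : ℕ) h' f hf) (hom_ext fun _ => rfl)

variable [Φ.Additive] [Φ.Linear k]

/-- The extension of `Φ` to homogeneous maps of degree `n`, induced by `θ`. -/
def degMap (M N : GrMod.{v, u, w} 𝒜) (n : ℤ) :
    homDeg M N n →ₗ[k] (Φ.obj M →ₗ[Bᵐᵒᵖ] Φ.obj N) where
  -- Splitting `n` into positive and negative parts means only nonnegative iterates of `θ` are
  -- needed.
  toFun f := conjMap θ n.toNat (-n).toNat (shiftHom _ _ (by omega) f.1 f.2)
  map_add' f g := by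
    refine LinearMap.ext fun x => (conjMap_eq_iff θ).2 ?_
    rw [LinearMap.add_apply, map_add, ← (conjMap_eq_iff θ).1 rfl, ← (conjMap_eq_iff θ).1 rfl,
      ← LinearMap.add_apply, ← toLinear_add, ← Φ.map_add]
    rfl
  map_smul' c f := by
    refine LinearMap.ext fun x => (conjMap_eq_iff θ).2 ?_
    refine Eq.trans ?_ (LinearMap.map_smul_of_tower (iterEquiv θ _ N).toLinearMap c _).symm
    rw [LinearEquiv.coe_coe, ← (conjMap_eq_iff θ).1 rfl,
      ← LinearMap.smul_apply, ← toLinear_smul, ← Φ.map_smul]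
    rfl

theorem degMap_eq {M N : GrMod.{v, u, w} 𝒜} {n : ℤ} (f : homDeg M N n) (p q : ℕ)
    (h : (p : ℤ) - q = n) :
    degMap θ M N n f = conjMap θ p q (shiftHom _ _ h f.1 f.2) := by
  obtain ⟨r, rfl, rfl⟩ : ∃ r, p = n.toNat + r ∧ q = (-n).toNat + r :=
    ⟨p - n.toNat, by omega, by omega⟩
  exact (conjMap_shiftHom_add θ r (by omega) h f.1 f.2).symm

theorem degMap_mem {M N : GrMod.{v, u, w} 𝒜} {n : ℤ} (f : homDeg M N n) :
    degMap θ M N n f ∈ homDeg (Φ.obj M) (Φ.obj N) n := by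
  -- Generalizing the target degree to `l` allows substitution without rewriting the `n` inside `f`.
  have h : ∀ l : ℤ, (n.toNat : ℤ) - (-n).toNat = l →
      degMap θ M N n f ∈ homDeg (Φ.obj M) (Φ.obj N) l := by
    rintro _ rfl
    exact conjMap_mem θ n.toNat (-n).toNat (shiftHom _ _ (by omega) f.1 f.2)
  exact h n (by omega)

theorem comp_mem_homDeg {M N L : GrMod.{v, u, w} 𝒜} {m n l : ℤ} (h : m + n = l)
    {f : M →ₗ[Aᵐᵒᵖ] N} (hf : f ∈ homDeg M N m) {g : N →ₗ[Aᵐᵒᵖ] L} (hg : g ∈ homDeg N L n) :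
    g ∘ₗ f ∈ homDeg M L l := fun j x hx => by
  rw [← h, ← add_assoc]
  exact hg _ _ (hf _ _ hx)

/-- Shifts of source, middle and target are chosen so that both factors share the middle one; then
functoriality of `Φ` applies. -/
theorem degMap_comp {M N L : GrMod.{v, u, w} 𝒜} {m n l : ℤ} (h : m + n = l)
    (f : homDeg M N m) (g : homDeg N L n) :
    degMap θ M L l ⟨g.1 ∘ₗ f.1, comp_mem_homDeg h f.2 g.2⟩ =
      degMap θ N L n g ∘ₗ degMap θ M N m f := by
  rw [degMap_eq θ f (m.toNat + n.toNat) ((-m).toNat + n.toNat) (by omega),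
    degMap_eq θ g ((-m).toNat + n.toNat) ((-m).toNat + (-n).toNat) (by omega),
    degMap_eq θ _ (m.toNat + n.toNat) ((-m).toNat + (-n).toNat) (by omega), ← conjMap_comp]
  rfl

theorem degMap_zero_apply {M N : GrMod.{v, u, w} 𝒜} (f : M ⟶ N) (hf : toLinear f ∈ homDeg M N 0) :
    degMap θ M N 0 ⟨toLinear f, hf⟩ = toLinear (Φ.map f) := by
  refine LinearMap.ext fun x => (conjMap_eq_iff θ).2 ?_
  have h : (shiftByZero M).hom ≫ shiftHom (n := 0) (0 : ℕ) (0 : ℕ) rfl (toLinear f) hf =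
    f ≫ (shiftByZero N).hom := rfl
  exact (map_comp_apply Φ _ _ _).symm.trans ((congrArg (fun g => toLinear (Φ.map g) x) h).trans
    (map_comp_apply Φ _ _ _))

theorem degMap_injective [Φ.Faithful] (M N : GrMod.{v, u, w} 𝒜) (n : ℤ) :
    Function.Injective (degMap θ M N n) := by
  intro f g hfg
  have h : Φ.map (shiftHom n.toNat (-n).toNat (by omega) f.1 f.2) =
      Φ.map (shiftHom n.toNat (-n).toNat (by omega) g.1 g.2) := by
    refine hom_ext fun y => ?_
    obtain ⟨x, rfl⟩ := (iterEquiv θ _ M).surjective y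
    exact ((conjMap_eq_iff θ).1 (LinearMap.congr_fun hfg x)).trans
      ((conjMap_eq_iff θ).1 rfl).symm
  exact Subtype.ext (congrArg toLinear (Φ.map_injective h))

/-- Conjugating `g` by the iterates of `θ` gives a degree-preserving map `Φ(M⟨p⟩) ⟶ Φ(N⟨q⟩)`, to
which fullness applies. -/
theorem exists_degMap_eq [Φ.Full] {M N : GrMod.{v, u, w} 𝒜} {n : ℤ}
    {g : Φ.obj M →ₗ[Bᵐᵒᵖ] Φ.obj N} (hg : g ∈ homDeg (Φ.obj M) (Φ.obj N) n) :
    ∃ f : homDeg M N n, degMap θ M N n f = g := by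
  obtain ⟨p, q, h⟩ : ∃ p q : ℕ, (p : ℤ) - q = n := ⟨n.toNat, (-n).toNat, by omega⟩
  let g' : Φ.obj (shiftBy p M) ⟶ Φ.obj (shiftBy q N) :=
    ofLinearMap ((iterEquiv θ q N).toLinearMap ∘ₗ g ∘ₗ (iterEquiv θ p M).symm.toLinearMap)
      fun j y hy => by
        obtain ⟨x, rfl⟩ := (iterEquiv θ p M).surjective y
        simp only [LinearMap.comp_apply, LinearEquiv.coe_coe, LinearEquiv.symm_apply_apply]
        rw [iterEquiv_mem_iff] at hy ⊢
        have := hg _ _ hy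
        rwa [← h, show j - p + (p - q : ℤ) = j - q by ring] at this
  let f : M →ₗ[Aᵐᵒᵖ] N := toLinear (M := shiftBy p M) (N := shiftBy q N) (Φ.preimage g')
  have hf : f ∈ homDeg M N n := fun j m hm => by
    have : f m ∈ N.deg (j + p - q) :=
      toLinear_mem (M := shiftBy p M) (N := shiftBy q N) (Φ.preimage g') (j := j + p) (m := m)
        (show m ∈ M.deg (j + p - p) by rwa [add_sub_cancel_right])
    rwa [← h, ← add_sub_assoc]
  refine ⟨⟨f, hf⟩, ?_⟩
  rw [degMap_eq θ _ p q h]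
  refine LinearMap.ext fun x => (conjMap_eq_iff θ).2 ?_
  have : shiftHom (p : ℤ) (q : ℤ) h f hf = Φ.preimage g' := rfl
  rw [this, Φ.map_preimage]
  simp [g']

end Extend

/-! ### Evaluation at the generator and the isomorphism with `Hom(P, -)` -/

section Evaluation

variable {A : Type u} [Ring A] [Algebra k A] {𝒜 : ℤ → Submodule k A}
variable {B : Type u} [Ring B] [Algebra k B] {ℬ : ℤ → Submodule k B} [GradedAlgebra ℬ]
variable {Φ : GrMod.{v, u, u} 𝒜 ⥤ GrMod.{v, u, u} ℬ} (θ : Φ ⋙ shift ℬ ≅ shift 𝒜 ⋙ Φ)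
variable {P : GrMod.{v, u, u} 𝒜} (φ : Φ.obj P ≅ regular ℬ)

/-- The element of `Φ(P)` that corresponds to `1` under `Φ(P) ≅ B`. -/
def generator : Φ.obj P := toLinear φ.inv (regularOne ℬ)

theorem generator_mem : generator φ ∈ (Φ.obj P).deg 0 := toLinear_mem φ.inv one_mem_regular

theorem toLinear_inv_apply (b : B) : toLinear φ.inv b = op b • generator φ :=
  linearMap_apply_eq (Φ.obj P) (toLinear φ.inv) b

/-- The isomorphism `B ≃ Φ(P)` of `k`-modules. -/
def generatorEquiv : B ≃ₗ[k] Φ.obj P :=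
  (LinearEquiv.restrictScalars k (isoLinearEquiv φ).symm : regular ℬ ≃ₗ[k] Φ.obj P)

theorem generatorEquiv_apply (b : B) : generatorEquiv φ b = op b • generator φ :=
  toLinear_inv_apply φ b

theorem exists_smul_generator (y : Φ.obj P) : ∃ b : B, op b • generator φ = y := by
  exact ⟨toLinear φ.hom y,
    (toLinear_inv_apply φ _).symm.trans ((isoLinearEquiv φ).symm_apply_apply y)⟩

theorem exists_map_generator {N : GrMod.{v, u, u} ℬ} {n : ℤ} {x : N} (hx : x ∈ N.deg n) :
    ∃ g ∈ homDeg (Φ.obj P) N n, g (generator φ) = x := by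
  let g₀ : regular ℬ →ₗ[Bᵐᵒᵖ] N := genMap N x
  have hg₀ : g₀ ∈ homDeg (regular ℬ) N n := genMap_mem hx
  refine ⟨g₀ ∘ₗ toLinear φ.hom, comp_mem_homDeg (zero_add n) (toLinear_mem_homDeg φ.hom) hg₀, ?_⟩
  exact (congrArg g₀ ((isoLinearEquiv φ).apply_symm_apply (regularOne ℬ))).trans
    (genMap_one (A := B) N x)

variable [Φ.Additive] [Φ.Linear k]

/-- The map `Hom_A(P, N)_n → Φ(N)_n` that evaluates the extension of `Φ` at the generator. -/
def evalDeg (N : GrMod.{v, u, u} 𝒜) (n : ℤ) : homDeg P N n →ₗ[k] (Φ.obj N).deg n where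
  toFun f := ⟨degMap θ P N n f (generator φ), by
    have := degMap_mem θ f 0 _ (generator_mem φ)
    rwa [zero_add] at this⟩
  map_add' f g := by simp
  map_smul' c f := by simp

theorem evalDeg_bijective [Φ.Full] [Φ.Faithful] (N : GrMod.{v, u, u} 𝒜) (n : ℤ) :
    Function.Bijective (evalDeg θ φ N n) := by
  refine ⟨fun f g hfg => degMap_injective θ P N n (LinearMap.ext fun y => ?_), fun x => ?_⟩
  · obtain ⟨b, rfl⟩ := exists_smul_generator φ y
    rw [map_smul, map_smul]
    exact congrArg _ (congrArg Subtype.val hfg)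
  · obtain ⟨g, hg, hgx⟩ := exists_map_generator φ x.2
    obtain ⟨f, rfl⟩ := exists_degMap_eq θ hg
    exact ⟨f, Subtype.ext hgx⟩

/-- Each homogeneous element of `Φ(M)` is the value at the generator of some extended `h : P⟨n⟩ ⟶
M`, and `Φ(f)` sends it to the value of the extension of `f ∘ h = 0`. Finite generation of `P` plays
no role, so this can serve in proving `P` a progenerator. -/
theorem separates_shiftBy (θ : Φ ⋙ shift ℬ ≅ shift 𝒜 ⋙ Φ) (φ : Φ.obj P ≅ regular ℬ) [Φ.Full]
    [Φ.Faithful] : Separates fun n : ℤ => shiftBy n P := by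
  intro M N f hf
  refine Φ.map_injective ?_
  rw [Functor.map_zero]
  refine hom_ext fun x => ?_
  induction x using induction_homogeneous with
  | h0 => rw [map_zero, map_zero]
  | hadd x y hx hy => rw [map_add, map_add, hx, hy]
  | h n x hx =>
    obtain ⟨h, hh⟩ := (evalDeg_bijective θ φ M n).2 ⟨x, hx⟩
    have hh' : degMap θ P M n h (generator φ) = x := congrArg Subtype.val hh
    rw [← hh', ← degMap_zero_apply θ f (toLinear_mem_homDeg f)]
    refine (LinearMap.congr_fun (degMap_comp θ (add_zero n) h ⟨toLinear f, toLinear_mem_homDeg f⟩)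
      (generator φ)).symm.trans ?_
    have h0 : (⟨toLinear f ∘ₗ h.1, comp_mem_homDeg (add_zero n) h.2 (toLinear_mem_homDeg f)⟩ :
        homDeg P N n) = 0 :=
      Subtype.ext (congrArg (toLinear (M := shiftBy n P)) (hf n (shiftHomLeft h.1 h.2)))
    exact (congrArg (fun g => degMap θ P N n g (generator φ)) h0).trans (by simp)

variable [GradedAlgebra 𝒜] [Module.Finite Aᵐᵒᵖ P] [Φ.Full] [Φ.Faithful]

/-- The isomorphism `Hom_A(P, N) ≃ Φ(N)`, for `P` finitely generated. -/
def evalEquiv (N : GrMod.{v, u, u} 𝒜) : (P →ₗ[Aᵐᵒᵖ] N) ≃ₗ[k] Φ.obj N :=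
  (LinearEquiv.ofBijective (DirectSum.coeLinearMap (homDeg P N))
      (homDeg_isInternal P N)).symm.trans
    ((DFinsupp.mapRange.linearEquiv fun n =>
        LinearEquiv.ofBijective (evalDeg θ φ N n) (evalDeg_bijective θ φ N n)).trans
      (LinearEquiv.ofBijective (DirectSum.coeLinearMap (Φ.obj N).deg) (Φ.obj N).isInternal))

theorem evalEquiv_of_mem {N : GrMod.{v, u, u} 𝒜} {n : ℤ} (f : homDeg P N n) :
    evalEquiv θ φ N f.1 = degMap θ P N n f (generator φ) := by
  have h : (LinearEquiv.ofBijective (DirectSum.coeLinearMap (homDeg P N))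
      (homDeg_isInternal P N)).symm f.1 = DirectSum.lof k ℤ (fun n => homDeg P N n) n f := by
    rw [LinearEquiv.symm_apply_eq]
    exact (DirectSum.coeLinearMap_lof (homDeg P N) n f).symm
  rw [evalEquiv, LinearEquiv.trans_apply, LinearEquiv.trans_apply, h]
  refine (congrArg _ (DFinsupp.mapRange_single (f := fun n => evalDeg θ φ N n)
    (hf := fun n => map_zero _))).trans ?_
  exact DirectSum.coeLinearMap_lof (Φ.obj N).deg n (evalDeg θ φ N n f)

theorem evalEquiv_symm_mem {N : GrMod.{v, u, u} 𝒜} {n : ℤ} {x : Φ.obj N}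
    (hx : x ∈ (Φ.obj N).deg n) : (evalEquiv θ φ N).symm x ∈ homDeg P N n := by
  obtain ⟨f, hf⟩ := (evalDeg_bijective θ φ N n).2 ⟨x, hx⟩
  have : evalEquiv θ φ N f.1 = x := (evalEquiv_of_mem θ φ f).trans (congrArg Subtype.val hf)
  rw [← this, LinearEquiv.symm_apply_apply]
  exact f.2

theorem evalEquiv_mem_iff {N : GrMod.{v, u, u} 𝒜} {n : ℤ} {f : P →ₗ[Aᵐᵒᵖ] N} :
    evalEquiv θ φ N f ∈ (Φ.obj N).deg n ↔ f ∈ homDeg P N n := by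
  refine ⟨fun h => ?_, fun h => ?_⟩
  · rw [← (evalEquiv θ φ N).symm_apply_apply f]
    exact evalEquiv_symm_mem θ φ h
  · rw [evalEquiv_of_mem θ φ ⟨f, h⟩]
    exact (evalDeg θ φ N n ⟨f, h⟩).2

theorem hom_induction {N : GrMod.{v, u, u} 𝒜} {p : (P →ₗ[Aᵐᵒᵖ] N) → Prop} (h0 : p 0)
    (hadd : ∀ f g, p f → p g → p (f + g)) (h : ∀ n, ∀ f ∈ homDeg P N n, p f)
    (f : P →ₗ[Aᵐᵒᵖ] N) : p f := by
  rw [← (homDeg_isInternal P N).chooseDecomposition.left_inv f]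
  generalize (homDeg_isInternal P N).chooseDecomposition.decompose' f = x
  induction x using DirectSum.induction_on with
  | zero => rwa [map_zero]
  | of i f => rw [DirectSum.coeAddMonoidHom_of]; exact h i _ f.2
  | add x y hx hy => rw [map_add]; exact hadd _ _ hx hy

/-- With `e` the generator and `s` the endomorphism evaluating to `e · b`, functoriality gives `Φ(f
∘ s)(e) = Φ(f)(e · b) = Φ(f)(e) · b` on homogeneous elements; the rest is additivity. -/
theorem evalEquiv_comp {N : GrMod.{v, u, u} 𝒜} (f : P →ₗ[Aᵐᵒᵖ] N) (b : B) :
    evalEquiv θ φ N (f ∘ₗ (evalEquiv θ φ P).symm (op b • generator φ)) =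
      op b • evalEquiv θ φ N f := by
  induction f using hom_induction with
  | h0 => simp
  | hadd f g hf hg => rw [LinearMap.add_comp, map_add, hf, hg, map_add, smul_add]
  | h n f hf =>
    induction b using DirectSum.Decomposition.inductionOn ℬ with
    | zero => simp
    | add b c hb hc =>
      rw [MulOpposite.op_add, add_smul, map_add, LinearMap.comp_add, map_add, hb, hc, add_smul]
    | @homogeneous i b =>
      have hs := evalEquiv_symm_mem θ φ ((Φ.obj P).smul_mem (generator_mem φ) b.2)
      rw [zero_add] at hs
      rw [evalEquiv_of_mem θ φ ⟨f, hf⟩,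
        evalEquiv_of_mem θ φ ⟨f ∘ₗ _, comp_mem_homDeg rfl hs hf⟩]
      refine (LinearMap.congr_fun (degMap_comp θ rfl ⟨_, hs⟩ ⟨f, hf⟩) (generator φ)).trans ?_
      rw [LinearMap.comp_apply, ← evalEquiv_of_mem θ φ ⟨_, hs⟩, LinearEquiv.apply_symm_apply,
        map_smul]

theorem evalEquiv_naturality {N N' : GrMod.{v, u, u} 𝒜} (g : N ⟶ N') (f : P →ₗ[Aᵐᵒᵖ] N) :
    evalEquiv θ φ N' (toLinear g ∘ₗ f) = toLinear (Φ.map g) (evalEquiv θ φ N f) := by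
  induction f using hom_induction with
  | h0 => simp
  | hadd f f' hf hf' => rw [LinearMap.comp_add, map_add, hf, hf', map_add, map_add]
  | h n f hf =>
    rw [evalEquiv_of_mem θ φ ⟨f, hf⟩,
      evalEquiv_of_mem θ φ ⟨toLinear g ∘ₗ f, comp_mem_homDeg (add_zero n) hf
        (toLinear_mem_homDeg g)⟩,
      ← degMap_zero_apply θ g (toLinear_mem_homDeg g)]
    exact LinearMap.congr_fun (degMap_comp θ (add_zero n) ⟨f, hf⟩
      ⟨toLinear g, toLinear_mem_homDeg g⟩) _

theorem evalEquiv_id : evalEquiv θ φ P LinearMap.id = generator φ := by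
  refine (evalEquiv_of_mem θ φ ⟨toLinear (𝟙 P), toLinear_mem_homDeg (𝟙 P)⟩).trans ?_
  rw [degMap_zero_apply, Φ.map_id]
  rfl

/-- The isomorphism `B ≃ End_A(P)` of `k`-modules. -/
def endLinearEquiv : B ≃ₗ[k] Module.End Aᵐᵒᵖ P :=
  (generatorEquiv φ).trans (evalEquiv θ φ P).symm

theorem endLinearEquiv_apply (b : B) :
    endLinearEquiv θ φ b = (evalEquiv θ φ P).symm (op b • generator φ) :=
  congrArg (evalEquiv θ φ P).symm (generatorEquiv_apply φ b)

/-- The isomorphism `B ≅ End_A(P)` of graded algebras. -/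
def endIso : EndIso ℬ P where
  toAlgEquiv := AlgEquiv.ofLinearEquiv (endLinearEquiv θ φ)
    (by
      rw [endLinearEquiv_apply, LinearEquiv.symm_apply_eq, MulOpposite.op_one, one_smul]
      exact (evalEquiv_id θ φ).symm)
    (fun b c => by
      -- Both sides evaluate to `(e · b) · c`, with `e` the generator.
      refine (evalEquiv θ φ P).injective ?_
      refine Eq.trans ?_ ((congrArg (fun s => evalEquiv θ φ P (endLinearEquiv θ φ b ∘ₗ s))
        (endLinearEquiv_apply θ φ c)).trans (evalEquiv_comp θ φ _ c)).symm
      rw [endLinearEquiv_apply, endLinearEquiv_apply, LinearEquiv.apply_symm_apply,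
        LinearEquiv.apply_symm_apply, MulOpposite.op_mul, mul_smul])
  mem_iff i b := by
    refine Iff.trans ?_ (evalEquiv_mem_iff θ φ)
    refine Iff.trans ?_ (Eq.to_iff (congrArg (· ∈ (Φ.obj P).deg i)
      ((evalEquiv θ φ P).apply_symm_apply _))).symm
    exact (isoLinearEquiv_mem_iff φ.symm (m := b)).symm

/-- The isomorphism `Hom_A(P, N) ≅ Φ(N)` of graded modules. -/
def evalIso (N : GrMod.{v, u, u} 𝒜) : homObj P (endIso θ φ) N ≅ Φ.obj N :=
  isoOfLinearEquiv (M := homObj P (endIso θ φ) N)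
    { toFun := evalEquiv θ φ N
      invFun := (evalEquiv θ φ N).symm
      left_inv := (evalEquiv θ φ N).symm_apply_apply
      right_inv := (evalEquiv θ φ N).apply_symm_apply
      map_add' := fun f g => map_add (evalEquiv θ φ N) f g
      map_smul' := fun b f => (congrArg (fun s => evalEquiv θ φ N ((show P →ₗ[Aᵐᵒᵖ] N from f) ∘ₗ s))
        (endLinearEquiv_apply θ φ (unop b))).trans (evalEquiv_comp θ φ _ (unop b)) }
    (fun _ _ hf => (evalEquiv_mem_iff θ φ).2 hf)
    (fun _ _ hx => evalEquiv_symm_mem θ φ hx)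

/-- The isomorphism `Φ ≅ Hom_A(P, -)`. -/
def isoHomFunctor : Φ ≅ homFunctor P (endIso θ φ) :=
  (NatIso.ofComponents (F := homFunctor P (endIso θ φ)) (G := Φ) (evalIso θ φ)
    (fun g => hom_ext fun f => evalEquiv_naturality θ φ g f)).symm

end Evaluation

/-! ### The progenerator property -/

section Progenerator

variable {A : Type u} [Ring A] [Algebra k A] {𝒜 : ℤ → Submodule k A}
variable {B : Type u} [Ring B] [Algebra k B] {ℬ : ℤ → Submodule k B}

theorem preimage_mem_traceSubmonoid {Φ : GrMod.{v, u, w} 𝒜 ⥤ GrMod.{v, u, w} ℬ} [Φ.Additive]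
    [Φ.Full] [Φ.Faithful] {ι : Type*} {X : ι → GrMod.{v, u, w} 𝒜} {P : GrMod.{v, u, w} 𝒜}
    {M : GrMod.{v, u, w} ℬ} (φ : Φ.obj P ≅ M) {g : M ⟶ M}
    (hg : g ∈ traceSubmonoid (fun i => Φ.obj (X i)) M) :
    Φ.preimage (φ.hom ≫ g ≫ φ.inv) ∈ traceSubmonoid X P := by
  induction hg using AddSubmonoid.closure_induction with
  | mem g hg =>
    obtain ⟨i, c, d, rfl⟩ := hg
    refine AddSubmonoid.subset_closure
      ⟨i, Φ.preimage (φ.hom ≫ c), Φ.preimage (d ≫ φ.inv), Φ.map_injective ?_⟩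
    simp
  | zero =>
    convert zero_mem (traceSubmonoid X P) using 1
    exact Φ.map_injective (by simp)
  | add g g' _ _ hg hg' =>
    convert add_mem hg hg' using 1
    exact Φ.map_injective (by simp)

/-- A sum of maps through shifts of the regular module factors through a finite product of copies of
`A`, once gradings are forgotten. -/
theorem exists_factorization_of_mem_traceSubmonoid [GradedAlgebra 𝒜] {P : GrMod.{v, u, u} 𝒜}
    {g : P ⟶ P} (hg : g ∈ traceSubmonoid (fun n : ℤ => shiftBy n (regular 𝒜)) P) :
    ∃ (F : Type u) (_ : AddCommGroup F) (_ : Module Aᵐᵒᵖ F) (a : P →ₗ[Aᵐᵒᵖ] F)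
      (b : F →ₗ[Aᵐᵒᵖ] P), Module.Finite Aᵐᵒᵖ F ∧ Module.Projective Aᵐᵒᵖ F ∧
        b ∘ₗ a = toLinear g := by
  induction hg using AddSubmonoid.closure_induction with
  | mem g hg =>
    obtain ⟨n, c, d, rfl⟩ := hg
    have e : Aᵐᵒᵖ ≃ₗ[Aᵐᵒᵖ] A := LinearEquiv.ofBijective (LinearMap.toSpanSingleton Aᵐᵒᵖ A 1) <| by
      have h : ∀ r, LinearMap.toSpanSingleton Aᵐᵒᵖ A 1 r = unop r := fun r => one_mul (unop r)
      exact ⟨fun r s hrs => unop_injective (by rw [← h, ← h, hrs]), fun a => ⟨op a, h _⟩⟩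
    exact ⟨A, _, _, toLinear c, toLinear d, Module.Finite.equiv e, Module.Projective.of_equiv e,
      rfl⟩
  | zero => exact ⟨PUnit, _, inferInstance, 0, 0, inferInstance, inferInstance, rfl⟩
  | add g g' _ _ hg hg' =>
    obtain ⟨F, _, _, a, b, _, _, h⟩ := hg
    obtain ⟨F', _, _, a', b', _, _, h'⟩ := hg'
    exact ⟨F × F', _, _, a.prod a', b.coprod b', inferInstance, inferInstance, by
      rw [LinearMap.coprod_comp_prod, h, h', toLinear_add]⟩

theorem finite_projective_of_id_mem [GradedAlgebra 𝒜] {P : GrMod.{v, u, u} 𝒜}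
    (h : 𝟙 P ∈ traceSubmonoid (fun n : ℤ => shiftBy n (regular 𝒜)) P) :
    Module.Finite Aᵐᵒᵖ P ∧ Module.Projective Aᵐᵒᵖ P := by
  obtain ⟨F, _, _, a, b, _, _, hab⟩ := exists_factorization_of_mem_traceSubmonoid h
  exact ⟨Module.Finite.of_surjective b fun x => ⟨a x, LinearMap.congr_fun hab x⟩,
    Module.Projective.of_split a b hab⟩

/-- Forgetting gradings, `1` is a sum of values of maps `P → A`. Composing these with `a ↦ x · a`
writes any `x` in any module as a sum of values of maps from `P`. -/
theorem isSeparator_of_id_mem [GradedAlgebra 𝒜] {P : GrMod.{v, u, u} 𝒜}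
    (h : 𝟙 (regular 𝒜) ∈ traceSubmonoid (fun n : ℤ => shiftBy n P) (regular 𝒜)) :
    IsSeparator (ModuleCat.of Aᵐᵒᵖ P) := by
  refine (isSeparator_def _).2 fun X Y f g hfg => ModuleCat.hom_ext (LinearMap.ext fun x => ?_)
  let ev : regular 𝒜 →ₗ[Aᵐᵒᵖ] X := genMap X x
  have key : ∀ r ∈ traceSubmonoid (fun n : ℤ => shiftBy n P) (regular 𝒜),
      f.hom (ev (toLinear r (regularOne 𝒜))) = g.hom (ev (toLinear r (regularOne 𝒜))) := by
    intro r hr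
    induction hr using AddSubmonoid.closure_induction with
    | mem r hr =>
      obtain ⟨n, c, d, rfl⟩ := hr
      let d' : P →ₗ[Aᵐᵒᵖ] regular 𝒜 := toLinear (M := shiftBy n P) d
      exact LinearMap.congr_fun (congrArg ModuleCat.Hom.hom
        (hfg (ModuleCat.ofHom (ev ∘ₗ d')))) (toLinear c (regularOne 𝒜))
    | zero => simp
    | add r s _ _ hr hs =>
      rw [toLinear_add, LinearMap.add_apply, map_add, map_add, map_add, hr, hs]
  have h1 : ev (toLinear (𝟙 (regular 𝒜)) (regularOne 𝒜)) = x := genMap_one (A := A) X x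
  rw [← h1]
  exact key _ h

theorem isProgenerator_of_iso [GradedAlgebra 𝒜] [GradedAlgebra ℬ]
    (Φ : GrMod.{v, u, u} 𝒜 ≌ GrMod.{v, u, u} ℬ) [Φ.functor.Additive] [Φ.functor.Linear k]
    (θ : Φ.functor ⋙ shift ℬ ≅ shift 𝒜 ⋙ Φ.functor) {P : GrMod.{v, u, u} 𝒜}
    (φ : Φ.functor.obj P ≅ regular ℬ) : IsProgenerator P := by
  have h := preimage_mem_traceSubmonoid φ
    (separates_shiftBy_regular.map_equivalence Φ).id_regular_mem
  have h' := finite_projective_of_id_mem (P := P) (by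
    convert h using 1
    exact Φ.functor.map_injective (by simp))
  exact ⟨h'.1, h'.2, isSeparator_of_id_mem (separates_shiftBy θ φ).id_regular_mem⟩

/-- `Hom_A(P, -)` commutes with the shift. -/
def homFunctorShiftIso [GradedAlgebra 𝒜] (P : GrMod.{v, u, w} 𝒜) [Module.Finite Aᵐᵒᵖ P]
    (σ : EndIso ℬ P) : homFunctor P σ ⋙ shift ℬ ≅ shift 𝒜 ⋙ homFunctor P σ :=
  NatIso.ofComponents (fun N => isoOfLinearEquiv (M := shiftObj (homObj P σ N))
      (N := homObj P σ (shiftObj N)) (LinearEquiv.refl Bᵐᵒᵖ (homObj P σ N))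
      (fun j f hf l p hp => by
        have : (show P →ₗ[Aᵐᵒᵖ] N from f) p ∈ N.deg (l + (j - 1)) := hf l p hp
        rwa [← add_sub_assoc] at this)
      (fun j f hf l p hp => by
        have : (show P →ₗ[Aᵐᵒᵖ] N from f) p ∈ N.deg (l + j - 1) := hf l p hp
        rwa [add_sub_assoc] at this))
    (fun _ => rfl)

end Progenerator

end GradedMorita

end

/-! ### The equivalence of the two conditions -/

theorem corollary2p7 {k : Type v} [CommRing k]
    {R : Type u} [Ring R] [Algebra k R] (𝓡 : ℤ → Submodule k R) [GradedAlgebra 𝓡]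
    {S : Type u} [Ring S] [Algebra k S] (𝓢 : ℤ → Submodule k S) [GradedAlgebra 𝓢]
    (Φ : GradedMorita.GrMod.{v, u, u} 𝓡 ≌ GradedMorita.GrMod.{v, u, u} 𝓢)
    [Φ.functor.Additive] [Φ.functor.Linear k] :
    GradedMorita.IsGradedMorita Φ.functor ↔
      Nonempty (GradedMorita.pullback Φ (GradedMorita.shift 𝓢) ≅ GradedMorita.shift 𝓡) := by
  open GradedMorita in
  constructor
  · rintro ⟨P, hP, σ, ⟨α⟩⟩
    have := hP.finite
    have θ : Φ.functor ⋙ shift 𝓢 ≅ shift 𝓡 ⋙ Φ.functor :=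
      Functor.isoWhiskerRight α (shift 𝓢) ≪≫ homFunctorShiftIso P σ ≪≫
        Functor.isoWhiskerLeft (shift 𝓡) α.symm
    exact ⟨Functor.isoWhiskerRight θ Φ.inverse ≪≫
      Functor.isoWhiskerLeft (shift 𝓡) Φ.unitIso.symm ≪≫ (shift 𝓡).rightUnitor⟩
  · rintro ⟨α⟩
    -- Applying `Φ` to `α` leaves a factor `Φ ∘ Ψ`, which the counit removes.
    have θ : Φ.functor ⋙ shift 𝓢 ≅ shift 𝓡 ⋙ Φ.functor :=
      (Functor.isoWhiskerLeft (Φ.functor ⋙ shift 𝓢) Φ.counitIso).symm ≪≫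
        Functor.isoWhiskerRight α Φ.functor
    have φ : Φ.functor.obj (Φ.inverse.obj (regular 𝓢)) ≅ regular 𝓢 :=
      Φ.counitIso.app (regular 𝓢)
    have hP := isProgenerator_of_iso Φ θ φ
    have := hP.finite
    exact ⟨_, hP, endIso θ φ, ⟨isoHomFunctor θ φ⟩⟩
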